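/- **Theorem 1.2.** Let $n\ge 0$, let $\eta_0,\dots,\eta_n$ be independent standard complex normal random variables on a probability space, each with density $\frac1\pi e^{-|z|^2}$ with respect to area measure on $\mathbb{C}$ (so $\mathbb{E}[\eta_j]=0$ and $\mathbb{E}[|\eta_j|^2]=1$), and let $\phi_0,\dots,\phi_n$ be complex polynomials with $\deg\phi_j=j$. Put $$\Phi_n(z)=\sum_{j=0}^n\eta_j\phi_j(z),\qquad K_n(z,w)=\sum_{j=0}^n\phi_j(z)\overline{\phi_j(w)},\qquad K_n^{(0,1)}(z,w)=\sum_{j=0}^n\phi_j(z)\overline{\phi_j'(w)},$$ and let $v\in\mathbb{C}$. Let $\Theta\subset\mathbb{C}$ be a bounded domain (non-empty, open, connected) whose boundary $\partial\Theta$ is traced out by finitely many closed piecewise continuously differentiable paths and is positively oriented; that is, the union of the images of these paths is $\partial\Theta$, and their total winding number is $1$ about each point of $\Theta$ and $0$ about each point outside $\overline{\Theta}$. Let $N_\Theta^{\Phi_n,v}$ be the number, counted with multiplicity, of roots in $\Theta$ of the equation $\Phi_n(z)=v$ (set to $0$ on the null event that $\Phi_n$ is the constant $v$). Then $N_\Theta^{\Phi_n,v}$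 is integrable and $$\mathbb{E}\bigl[N_\Theta^{\Phi_n,v}\bigr]=\frac{1}{2\pi i}\oint_{\partial\Theta}\frac{\overline{K_n^{(0,1)}(z,z)}}{K_n(z,z)}\,\exp\!\left(-\frac{|v|^2}{K_n(z,z)}\right)dz .$$ -/

import Mathlib

open MeasureTheory ProbabilityTheory Polynomial Set

noncomputable section

namespace RandomLevelRoots

/-- A path in `ℂ`, parametrized by `[0, 1]`, is piecewise continuously differentiable:
`[0, 1]` is cut into finitely many closed intervals, on each of which the (automatically
continuous) path is `C¹`, with one-sided derivatives at the end points. -/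
def IsPiecewiseC1 {x y : ℂ} (γ : Path x y) : Prop :=
  ∃ (m : ℕ) (s : ℕ → ℝ), s 0 = 0 ∧ s m = 1 ∧
    ∀ k < m, s k < s (k + 1) ∧ ContDiffOn ℝ 1 γ.extend (Icc (s k) (s (k + 1)))

/-- A cycle: finitely many closed piecewise `C¹` paths in `ℂ`. -/
structure Cycle where
  /-- the number of closed paths -/
  num : ℕ
  /-- the base points -/
  base : Fin num → ℂ
  /-- the closed paths -/
  path : ∀ i, Path (base i) (base i)
  piecewiseC1 : ∀ i, IsPiecewiseC1 (path i)

namespace Cycle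

/-- The set of points of the plane through which the cycle passes. -/
def trace (Γ : Cycle) : Set ℂ := ⋃ i, range (Γ.path i)

/-- The contour integral `∮_Γ f(z) dz = ∑ᵢ ∫₀¹ f(γᵢ(t)) γᵢ'(t) dt`. -/
def integral (Γ : Cycle) (f : ℂ → ℂ) : ℂ :=
  ∑ i, ∫ᶜ z in Γ.path i, ContinuousLinearMap.toSpanSingleton ℂ (f z)

/-- The index (winding number) of the cycle about a point off its trace,
`(1 / 2πi) ∮_Γ dz / (z - a)`. -/
def index (Γ : Cycle) (a : ℂ) : ℂ :=
  (2 * Real.pi * Complex.I)⁻¹ * Γ.integral fun z => (z - a)⁻¹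

/-- `Γ` is the positively oriented boundary `∂Θ`: it runs through exactly the boundary
points of `Θ`, winding once (counterclockwise) around each point of `Θ` and not at all around
the points outside the closure of `Θ`. -/
structure IsPositiveBoundary (Γ : Cycle) (Θ : Set ℂ) : Prop where
  trace_eq : Γ.trace = frontier Θ
  index_inside : ∀ a ∈ Θ, Γ.index a = 1
  index_outside : ∀ a ∉ closure Θ, Γ.index a = 0

end Cycle

/-- The standard complex normal law on `ℂ = ℝ²`, with density `π⁻¹ exp(-|z|²)` with respect to
the area measure. -/
def stdComplexNormal : Measure ℂ :=
  volume.withDensity fun z => ENNReal.ofReal (Real.pi⁻¹ * Real.exp (-‖z‖ ^ 2))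

variable {n : ℕ}

/-- The polynomial `∑_{j=0}^n c_j φ_j`. -/
def combination (φ : Fin (n + 1) → ℂ[X]) (c : Fin (n + 1) → ℂ) : ℂ[X] :=
  ∑ j, C (c j) * φ j

open Classical in
/-- The number, with multiplicity, of the roots in `Θ` of the equation `p(z) = v`
(by convention `0` if `p` is the constant `v`). -/
def numRoots (p : ℂ[X]) (v : ℂ) (Θ : Set ℂ) : ℕ :=
  Multiset.countP (· ∈ Θ) (p - C v).roots

/-- The kernel `K_n^{(k,l)}(z, w) = ∑_{j=0}^n φ_j^{(k)}(z) conj(φ_j^{(l)}(w))`. -/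
def kernelDeriv (φ : Fin (n + 1) → ℂ[X]) (k l : ℕ) (z w : ℂ) : ℂ :=
  ∑ j, (derivative^[k] (φ j)).eval z * (starRingEnd ℂ) ((derivative^[l] (φ j)).eval w)

/-- The reproducing kernel `K_n(z, w) = ∑_{j=0}^n φ_j(z) conj(φ_j(w))`. -/
def kernel (φ : Fin (n + 1) → ℂ[X]) (z w : ℂ) : ℂ :=
  ∑ j, (φ j).eval z * (starRingEnd ℂ) ((φ j).eval w)

end RandomLevelRoots

end

namespace RandomLevelRoots

/-! The root count is the contour integral of `Φ' / (Φ - v)` over `∂Θ`, divided by `2πi`, as long as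
`Φ` does not take the value `v` on `∂Θ`. This holds almost surely: `∂Θ` is a null set and the
constant term of `Φ` has a density (`ae_forall_eval_combination_ne`). Taking expectations and
exchanging them with the contour integral leaves `E[Φ'(z) / (Φ(z) - v)]` at a fixed `z`.

There `Φ(z)` and `Φ'(z)` are linear forms in a standard Gaussian vector, with coefficient vectors
`a` and `b`. A unitary change of variables turns `Φ(z)` into `s c₀` with `s = |a|`. The part of
`Φ'(z)` independent of `c₀` has mean zero and drops out, and `integral_div_sub`, that is `E[c / (c -
w)] = exp(-|w|²)`, evaluates the rest.

The exchange needs a bound uniform along `∂Θ`. Because `φ₀` is constant, `Φ'` does not involve `c₀`,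
so `c₀` can be integrated first, and `1 / (c₀ - w)` has Gaussian `L¹` norm bounded uniformly in `w`.
-/

/-! ### Piecewise `C¹` paths: null image and bounded speed. -/

theorem exists_mem_Ico_of_partition {m : ℕ} {s : ℕ → ℝ} {t : ℝ} (h0 : s 0 ≤ t) (hm : t < s m) :
    ∃ k < m, t ∈ Ico (s k) (s (k + 1)) := by
  induction m with
  | zero => exact absurd h0 (not_le.2 hm)
  | succ m ih =>
    rcases lt_or_ge t (s m) with h | h
    · obtain ⟨k, hk, hkt⟩ := ih h
      exact ⟨k, hk.trans m.lt_succ_self, hkt⟩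
    · exact ⟨m, m.lt_succ_self, h, hm⟩

/-- A `C¹` map does not raise Hausdorff dimension, so the image has dimension at most 1, and area is
absolutely continuous with respect to 2-dimensional Hausdorff measure. -/
theorem volume_image_eq_zero_of_contDiffOn {f : ℝ → ℂ} {s : Set ℝ} (hs : Convex ℝ s)
    (hf : ContDiffOn ℝ 1 f s) : volume (f '' s) = 0 := by
  have h : dimH (f '' s) < (2 : NNReal) := by
    refine lt_of_le_of_lt ((hf.dimH_image_le hs subset_rfl).trans (dimH_mono (subset_univ s))) ?_
    rw [Real.dimH_univ]
    norm_num
  have h2 : (μH[(2 : NNReal)] : Measure ℂ) = μH[Module.finrank ℝ ℂ] := by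
    rw [Complex.finrank_real_complex]; norm_num
  refine measure_zero_of_dimH_lt ?_ h
  rw [h2]
  exact Measure.absolutelyContinuous_isAddHaarMeasure _ _

theorem IsPiecewiseC1.volume_range {x y : ℂ} {γ : Path x y} (hγ : IsPiecewiseC1 γ) :
    volume (range γ) = 0 := by
  obtain ⟨m, s, h0, hm, h⟩ := hγ
  -- The end point is listed separately because the partition lemma locates only `t < s m = 1`.
  have hsub : range γ ⊆ (⋃ k ∈ Iio m, γ.extend '' Icc (s k) (s (k + 1))) ∪ {γ.extend 1} := by
    rintro _ ⟨t, rfl⟩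
    rw [← Path.extend_apply γ t.2]
    rcases lt_or_eq_of_le t.2.2 with ht | ht
    · obtain ⟨k, hk, hkt⟩ := exists_mem_Ico_of_partition (h0.trans_le t.2.1) (hm ▸ ht)
      exact .inl (mem_biUnion (show k ∈ Iio m from hk)
        (mem_image_of_mem _ (Ico_subset_Icc_self hkt)))
    · exact .inr (by rw [ht]; rfl)
  refine measure_mono_null hsub (measure_union_null ?_ (measure_singleton _))
  refine (measure_biUnion_null_iff (finite_Iio m).countable).2 fun k hk => ?_
  exact volume_image_eq_zero_of_contDiffOn (convex_Icc _ _) (h k hk).2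

/-- Each piece is Lipschitz on a compact interval, and the sum of the Lipschitz constants dominates
them all. The break points, where `deriv` is not controlled, form a finite set. -/
theorem IsPiecewiseC1.exists_bound_deriv {x y : ℂ} {γ : Path x y} (hγ : IsPiecewiseC1 γ) :
    ∃ C : ℝ, ∀ᵐ t ∂volume.restrict (Ioc 0 1), ‖deriv γ.extend t‖ ≤ C := by
  obtain ⟨m, s, h0, hm, h⟩ := hγ
  have hK : ∀ k < m, ∃ C : NNReal, LipschitzOnWith C γ.extend (Icc (s k) (s (k + 1))) :=
    fun k hk => (h k hk).2.exists_lipschitzOnWith one_ne_zero (convex_Icc _ _) isCompact_Icc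
  choose! K hK using hK
  refine ⟨∑ k ∈ Finset.range m, (K k : ℝ), ?_⟩
  have hne : ∀ᵐ t ∂volume.restrict (Ioc (0 : ℝ) 1), t ∉ s '' Iic m :=
    ae_restrict_of_ae (measure_eq_zero_iff_ae_notMem.1
      (((finite_Iic m).image s).measure_zero volume))
  filter_upwards [hne, ae_restrict_mem measurableSet_Ioc] with t ht ht01
  have ht1 : t < s m := by
    rw [hm]
    refine lt_of_le_of_ne ht01.2 fun h1 => ht ⟨m, le_refl m, by rw [hm, h1]⟩
  obtain ⟨k, hk, hkt⟩ := exists_mem_Ico_of_partition (h0.trans_le ht01.1.le) ht1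
  have hkt' : t ∈ Ioo (s k) (s (k + 1)) :=
    ⟨lt_of_le_of_ne hkt.1 fun h1 => ht ⟨k, hk.le, h1⟩, hkt.2⟩
  refine (norm_deriv_le_of_lipschitzOn (Icc_mem_nhds hkt'.1 hkt'.2) (hK k hk)).trans ?_
  exact Finset.single_le_sum (f := fun k => (K k : ℝ)) (fun _ _ => NNReal.coe_nonneg _)
    (Finset.mem_range.2 hk)

namespace Cycle

theorem integral_eq_sum_deriv (Γ : Cycle) (f : ℂ → ℂ) :
    Γ.integral f =
      ∑ i, ∫ t in Ioc (0 : ℝ) 1, deriv (Γ.path i).extend t * f ((Γ.path i).extend t) := by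
  unfold integral
  refine Finset.sum_congr rfl fun i _ => ?_
  rw [curveIntegral_eq_intervalIntegral_deriv, intervalIntegral.integral_of_le zero_le_one]
  rfl

theorem volume_trace (Γ : Cycle) : volume Γ.trace = 0 :=
  measure_iUnion_null fun i => (Γ.piecewiseC1 i).volume_range

theorem extend_mem_trace (Γ : Cycle) (i : Fin Γ.num) (t : ℝ) :
    (Γ.path i).extend t ∈ Γ.trace := by
  refine mem_iUnion.2 ⟨i, ?_⟩
  rw [← Path.extend_range]
  exact mem_range_self t

theorem isCompact_trace (Γ : Cycle) : IsCompact Γ.trace :=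
  isCompact_iUnion fun i => isCompact_range (Γ.path i).continuous

theorem integrable_deriv_mul (Γ : Cycle) (i : Fin Γ.num) {f : ℂ → ℂ}
    (hf : ContinuousOn f Γ.trace) :
    Integrable (fun t => deriv (Γ.path i).extend t * f ((Γ.path i).extend t))
      (volume.restrict (Ioc (0 : ℝ) 1)) := by
  obtain ⟨C, hC⟩ := (Γ.piecewiseC1 i).exists_bound_deriv
  have hc : Continuous fun t => f ((Γ.path i).extend t) :=
    hf.comp_continuous (Γ.path i).continuous_extend (Γ.extend_mem_trace i)
  refine Integrable.bdd_mul (c := C) ?_ ?_ hC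
  · exact (hc.integrableOn_Icc (a := 0) (b := 1)).mono_set Ioc_subset_Icc_self
  · exact (measurable_deriv _).aestronglyMeasurable

theorem integral_add (Γ : Cycle) {f g : ℂ → ℂ} (hf : ContinuousOn f Γ.trace)
    (hg : ContinuousOn g Γ.trace) :
    (Γ.integral fun z => f z + g z) = Γ.integral f + Γ.integral g := by
  simp only [integral_eq_sum_deriv, mul_add, ← Finset.sum_add_distrib]
  refine Finset.sum_congr rfl fun i _ => ?_
  exact MeasureTheory.integral_add (Γ.integrable_deriv_mul i hf) (Γ.integrable_deriv_mul i hg)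

theorem integral_congr (Γ : Cycle) {f g : ℂ → ℂ} (h : ∀ z ∈ Γ.trace, f z = g z) :
    Γ.integral f = Γ.integral g := by
  simp only [integral_eq_sum_deriv]
  exact Finset.sum_congr rfl fun i _ => by simp only [h _ (Γ.extend_mem_trace i _)]

end Cycle

/-! ### The standard complex normal law and `E[c / (c - w)]`. -/

theorem measurable_ofReal_gaussianDensity :
    Measurable fun z : ℂ => ENNReal.ofReal (Real.pi⁻¹ * Real.exp (-‖z‖ ^ 2)) := by fun_prop

theorem integrable_exp_neg_mul_norm_sq {b : ℝ} (hb : 0 < b) :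
    Integrable fun z : ℂ => Real.exp (-b * ‖z‖ ^ 2) := by
  -- The Bochner integral of a non-integrable function is `0` by convention, so a nonzero value
  -- proves integrability.
  refine .of_integral_ne_zero ?_
  rw [GaussianFourier.integral_rexp_neg_mul_sq_norm hb]
  positivity

theorem integral_gaussianDensity : ∫ z : ℂ, Real.pi⁻¹ * Real.exp (-‖z‖ ^ 2) = 1 := by
  have h := GaussianFourier.integral_rexp_neg_mul_sq_norm (V := ℂ) one_pos
  simp only [neg_mul, one_mul, Complex.finrank_real_complex, div_one] at h
  rw [integral_const_mul, h]
  norm_num [Real.pi_ne_zero]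

theorem integrable_gaussianDensity :
    Integrable fun z : ℂ => Real.pi⁻¹ * Real.exp (-‖z‖ ^ 2) := by
  simpa using (integrable_exp_neg_mul_norm_sq one_pos).const_mul Real.pi⁻¹

instance isProbabilityMeasure_stdComplexNormal : IsProbabilityMeasure stdComplexNormal := by
  constructor
  rw [stdComplexNormal, withDensity_apply _ MeasurableSet.univ, Measure.restrict_univ,
    ← ofReal_integral_eq_lintegral_ofReal integrable_gaussianDensity
      (Filter.Eventually.of_forall fun z => by positivity), integral_gaussianDensity,
    ENNReal.ofReal_one]

theorem stdComplexNormal_absolutelyContinuous : stdComplexNormal ≪ volume :=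
  withDensity_absolutelyContinuous _ _

theorem integral_stdComplexNormal (f : ℂ → ℂ) :
    ∫ z, f z ∂stdComplexNormal = ∫ z, (Real.pi⁻¹ * Real.exp (-‖z‖ ^ 2)) • f z := by
  rw [stdComplexNormal, integral_withDensity_eq_integral_toReal_smul
    measurable_ofReal_gaussianDensity (Filter.Eventually.of_forall fun _ => ENNReal.ofReal_lt_top)]
  refine integral_congr_ae (Filter.Eventually.of_forall fun z => ?_)
  simp only
  rw [ENNReal.toReal_ofReal (by positivity)]

theorem integrable_stdComplexNormal_iff {f : ℂ → ℂ} :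
    Integrable f stdComplexNormal ↔
      Integrable fun z => (Real.pi⁻¹ * Real.exp (-‖z‖ ^ 2)) • f z := by
  rw [stdComplexNormal, integrable_withDensity_iff_integrable_smul'
    measurable_ofReal_gaussianDensity (Filter.Eventually.of_forall fun _ => ENNReal.ofReal_lt_top)]
  refine integrable_congr (Filter.Eventually.of_forall fun z => ?_)
  simp only
  rw [ENNReal.toReal_ofReal (by positivity)]

theorem integrable_id_stdComplexNormal : Integrable (fun z : ℂ => z) stdComplexNormal := by
  rw [integrable_stdComplexNormal_iff]
  refine ((integrable_exp_neg_mul_norm_sq (b := 1 / 2) (by norm_num)).const_mul Real.pi⁻¹).mono'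
    (Continuous.aestronglyMeasurable (by fun_prop)) (Filter.Eventually.of_forall fun z => ?_)
  rw [norm_smul, Real.norm_of_nonneg (by positivity), mul_assoc]
  gcongr
  have h1 : ‖z‖ ≤ Real.exp (1 / 2 * ‖z‖ ^ 2) := by
    nlinarith [Real.add_one_le_exp (1 / 2 * ‖z‖ ^ 2), sq_nonneg (‖z‖ - 1)]
  calc Real.exp (-‖z‖ ^ 2) * ‖z‖ ≤ Real.exp (-‖z‖ ^ 2) * Real.exp (1 / 2 * ‖z‖ ^ 2) := by gcongr
    _ = Real.exp (-(1 / 2) * ‖z‖ ^ 2) := by rw [← Real.exp_add]; ring_nf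

theorem integral_id_stdComplexNormal : ∫ z : ℂ, z ∂stdComplexNormal = 0 := by
  rw [integral_stdComplexNormal]
  have h := integral_neg_eq_self (fun z : ℂ => (Real.pi⁻¹ * Real.exp (-‖z‖ ^ 2)) • z) volume
  simp only [norm_neg, smul_neg, integral_neg] at h
  exact CharZero.neg_eq_self_iff.1 h

/-- In polar coordinates the Jacobian `r` cancels the singularity `1 / r`. -/
theorem lintegral_indicator_ball_inv_lt_top :
    ∫⁻ z : ℂ, (Metric.ball (0 : ℂ) 1).indicator (fun z => ‖z⁻¹‖ₑ) z < ⊤ := by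
  rw [← Complex.lintegral_comp_polarCoord_symm]
  have hT : MeasurableSet (polarCoord.target) := polarCoord.open_target.measurableSet
  calc _ ≤ ∫⁻ p in polarCoord.target,
        (Ioo (0 : ℝ) 1 ×ˢ Ioo (-Real.pi) Real.pi).indicator 1 p := by
        refine setLIntegral_mono_ae (Measurable.aemeasurable
          (measurable_one.indicator (measurableSet_Ioo.prod measurableSet_Ioo)))
          (Filter.Eventually.of_forall fun p hp => ?_)
        have hp0 : 0 < p.1 := hp.1
        have hn : ‖Complex.polarCoord.symm p‖ = p.1 := by
          rw [Complex.norm_polarCoord_symm, abs_of_pos hp0]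
        by_cases h1 : p.1 < 1
        · rw [indicator_of_mem (by rwa [mem_ball_zero_iff, hn]),
            indicator_of_mem (show p ∈ Ioo (0 : ℝ) 1 ×ˢ Ioo (-Real.pi) Real.pi from
              ⟨⟨hp0, h1⟩, hp.2⟩)]
          rw [← ofReal_norm, norm_inv, hn, smul_eq_mul, ← ENNReal.ofReal_mul hp0.le,
            mul_inv_cancel₀ hp0.ne', ENNReal.ofReal_one]
          rfl
        · rw [indicator_of_notMem (by rwa [mem_ball_zero_iff, hn]), smul_zero]
          exact zero_le
    _ ≤ ∫⁻ p, (Ioo (0 : ℝ) 1 ×ˢ Ioo (-Real.pi) Real.pi).indicator 1 p := setLIntegral_le_lintegral _ _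
    _ < ⊤ := by
        rw [lintegral_indicator_one (measurableSet_Ioo.prod measurableSet_Ioo),
          Measure.volume_eq_prod, Measure.prod_prod, Real.volume_Ioo, Real.volume_Ioo]
        exact ENNReal.mul_lt_top ENNReal.ofReal_lt_top ENNReal.ofReal_lt_top

/-- Outside the unit disc about `b` the integrand is at most 1. Inside it, the density is at most `1
/ π`, and translation invariance of area removes `b`. Uniformity in `b` is what later justifies
Fubini. -/
theorem exists_lintegral_inv_sub_le :
    ∃ C : ENNReal, C ≠ ⊤ ∧ ∀ b : ℂ, ∫⁻ z, ‖(z - b)⁻¹‖ₑ ∂stdComplexNormal ≤ C := by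
  set F : ℂ → ENNReal := (Metric.ball (0 : ℂ) 1).indicator (fun z => ‖z⁻¹‖ₑ) with hF
  have hFm : Measurable F :=
    Measurable.indicator (by fun_prop) Metric.isOpen_ball.measurableSet
  refine ⟨1 + ENNReal.ofReal Real.pi⁻¹ * ∫⁻ z : ℂ, F z, ?_, fun b => ?_⟩
  · exact ENNReal.add_ne_top.2 ⟨ENNReal.one_ne_top, ENNReal.mul_ne_top ENNReal.ofReal_ne_top
      lintegral_indicator_ball_inv_lt_top.ne⟩
  have hpt : ∀ z : ℂ, ‖(z - b)⁻¹‖ₑ ≤ 1 + F (z - b) := by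
    intro z
    by_cases h : z - b ∈ Metric.ball (0 : ℂ) 1
    · rw [hF, indicator_of_mem h]
      exact le_add_self
    · refine le_add_right ?_
      rw [← ofReal_norm, ← ENNReal.ofReal_one]
      refine ENNReal.ofReal_le_ofReal ?_
      rw [norm_inv]
      exact inv_le_one_of_one_le₀ (by simpa using h)
  calc ∫⁻ z, ‖(z - b)⁻¹‖ₑ ∂stdComplexNormal ≤ ∫⁻ z, 1 + F (z - b) ∂stdComplexNormal :=
        lintegral_mono hpt
    _ = 1 + ∫⁻ z, F (z - b) ∂stdComplexNormal := by
        rw [lintegral_add_left measurable_const]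
        simp
    _ ≤ 1 + ENNReal.ofReal Real.pi⁻¹ * ∫⁻ z : ℂ, F z := by
        gcongr
        rw [stdComplexNormal, lintegral_withDensity_eq_lintegral_mul _
          measurable_ofReal_gaussianDensity (show Measurable fun z => F (z - b) from hFm.comp (measurable_id.sub_const b)),
          ← lintegral_const_mul _ hFm, ← lintegral_sub_right_eq_self (fun z => ENNReal.ofReal Real.pi⁻¹ * F z) b]
        refine lintegral_mono fun z => ?_
        simp only [Pi.mul_apply]
        gcongr
        refine mul_le_of_le_one_right (by positivity) ?_
        exact Real.exp_le_one_iff.2 (by nlinarith [norm_nonneg z])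

theorem integrable_inv_sub (b : ℂ) : Integrable (fun z => (z - b)⁻¹) stdComplexNormal := by
  obtain ⟨C, hC, h⟩ := exists_lintegral_inv_sub_le
  exact ⟨Measurable.aestronglyMeasurable (by fun_prop), (h b).trans_lt hC.lt_top⟩

theorem stdComplexNormal_ae_ne (w : ℂ) : ∀ᵐ z ∂stdComplexNormal, z ≠ w :=
  stdComplexNormal_absolutelyContinuous.ae_le (Measure.ae_ne volume w)

theorem integrable_div_sub (w : ℂ) : Integrable (fun z => z / (z - w)) stdComplexNormal := by
  refine ((integrable_const (1 : ℂ)).add ((integrable_inv_sub w).const_mul w)).congr ?_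
  filter_upwards [stdComplexNormal_ae_ne w] with z hz
  have : z - w ≠ 0 := sub_ne_zero.2 hz
  simp only [Pi.add_apply]
  field_simp
  ring

/-- Since `dz = i z dθ`, this is `∮ dz / (z - w)` up to the factor `1 / i`, so Cauchy's theorem
decides it by the position of `w`. -/
theorem integral_circleMap_div_sub {r : ℝ} (hr : 0 < r) {w : ℂ} (hw : r ≠ ‖w‖) :
    ∫ θ in Ioo (-Real.pi) Real.pi, circleMap 0 r θ / (circleMap 0 r θ - w) =
      if ‖w‖ < r then 2 * (Real.pi : ℂ) else 0 := by
  have h1 : ∫ θ in Ioo (-Real.pi) Real.pi, circleMap 0 r θ / (circleMap 0 r θ - w) =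
      Complex.I⁻¹ * ∮ z in C(0, r), (z - w)⁻¹ := by
    rw [← integral_Ioc_eq_integral_Ioo,
      ← intervalIntegral.integral_of_le (by linarith [Real.pi_pos]), circleIntegral,
      ← intervalIntegral.integral_const_mul]
    have hp : Function.Periodic (fun θ => circleMap 0 r θ / (circleMap 0 r θ - w))
        (2 * Real.pi) := fun θ => by simp only [periodic_circleMap 0 r θ]
    have := hp.intervalIntegral_add_eq (-Real.pi) 0
    rw [show -Real.pi + 2 * Real.pi = Real.pi by ring, zero_add] at this
    rw [this]
    refine intervalIntegral.integral_congr fun θ _ => ?_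
    simp only [deriv_circleMap, smul_eq_mul]
    field_simp [Complex.I_ne_zero]
  rw [h1]
  split_ifs with h
  · rw [circleIntegral.integral_sub_inv_of_mem_ball (by simpa using h)]
    field_simp [Complex.I_ne_zero]
  · have h' : r < ‖w‖ := lt_of_le_of_ne (not_lt.1 h) hw
    have hne : ∀ z ∈ Metric.closedBall (0 : ℂ) r, z - w ≠ 0 := fun z hz h0 => by
      rw [sub_eq_zero.1 h0, mem_closedBall_zero_iff] at hz
      linarith
    rw [Complex.circleIntegral_eq_zero_of_differentiable_on_off_countable hr.le countable_empty,
      mul_zero]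
    · exact (continuousOn_id.sub continuousOn_const).inv₀ hne
    · intro z hz
      exact (differentiableAt_id.sub_const w).inv (hne z (Metric.ball_subset_closedBall hz.1))

theorem integral_Ioi_mul_exp_neg_sq {a : ℝ} (ha : 0 ≤ a) :
    ∫ r in Ioi a, ((2 * r * Real.exp (-r ^ 2) : ℝ) : ℂ) = Real.exp (-a ^ 2) := by
  -- The limit is written `-0` to match the negation of `exp (-r²) → 0`.
  have h := integral_Ioi_of_hasDerivAt_of_nonneg' (g := fun r : ℝ => -Real.exp (-r ^ 2))
    (g' := fun r => 2 * r * Real.exp (-r ^ 2)) (a := a) (l := -0) ?_ ?_ ?_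
  · rw [integral_complex_ofReal, h]
    simp
  · intro x _
    convert! ((hasDerivAt_pow 2 x).neg.exp).neg using 1
    simp
    ring
  · intro x hx
    have : 0 < x := ha.trans_lt hx
    positivity
  · exact (Real.tendsto_exp_neg_atTop_nhds_zero.comp
      (Filter.tendsto_pow_atTop two_ne_zero)).neg

/-- In polar coordinates the angular integral kills every circle with `r < |w|` and gives `2π` on
those with `r > |w|`. What remains is the tail `∫ 2 r exp(-r²) dr` over `r > |w|`. -/
theorem integral_div_sub (w : ℂ) :
    ∫ z, z / (z - w) ∂stdComplexNormal = Real.exp (-‖w‖ ^ 2) := by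
  have hint := integrable_stdComplexNormal_iff.1 (integrable_div_sub w)
  rw [integral_stdComplexNormal, ← Complex.integral_comp_polarCoord_symm]
  set f : ℂ → ℂ := fun z => (Real.pi⁻¹ * Real.exp (-‖z‖ ^ 2)) • (z / (z - w)) with hf
  have hfm : Measurable f := by fun_prop
  have hI : IntegrableOn (fun p : ℝ × ℝ => p.1 • f (Complex.polarCoord.symm p))
      polarCoord.target := by
    refine ⟨Measurable.aestronglyMeasurable ?_, ?_⟩
    · simp only [Complex.polarCoord_symm_apply]
      fun_prop
    · have h2 := Complex.lintegral_comp_polarCoord_symm fun z => ‖f z‖ₑ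
      have h3 := hint.2
      rw [HasFiniteIntegral] at h3 ⊢
      rw [← h2] at h3
      refine lt_of_le_of_lt (le_of_eq ?_) h3
      refine setLIntegral_congr_fun polarCoord.open_target.measurableSet fun p hp => ?_
      have hp0 : 0 < p.1 := hp.1
      simp only [enorm_smul, smul_eq_mul]
      rw [Real.enorm_of_nonneg hp0.le]
  rw [polarCoord_target] at hI ⊢
  rw [Measure.volume_eq_prod] at hI ⊢
  rw [setIntegral_prod _ hI]
  have hinner : ∀ r ∈ Ioi (0 : ℝ), r ≠ ‖w‖ →
      ∫ θ in Ioo (-Real.pi) Real.pi, r • f (Complex.polarCoord.symm (r, θ)) =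
        (Ioi ‖w‖).indicator (fun r => ((2 * r * Real.exp (-r ^ 2) : ℝ) : ℂ)) r := by
    intro r hr hrw
    have hr' : 0 < r := hr
    have hc : ∀ θ : ℝ, r • f (Complex.polarCoord.symm (r, θ)) =
        ((r * (Real.pi⁻¹ * Real.exp (-r ^ 2)) : ℝ) : ℂ) *
          (circleMap 0 r θ / (circleMap 0 r θ - w)) := by
      intro θ
      have hz : Complex.polarCoord.symm (r, θ) = circleMap 0 r θ := by
        rw [Complex.polarCoord_symm_apply, circleMap, Complex.exp_mul_I]
        push_cast
        ring
      rw [hz, hf]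
      simp only [norm_circleMap_zero, abs_of_pos hr', Complex.real_smul]
      push_cast
      ring
    simp only [hc]
    rw [integral_const_mul, integral_circleMap_div_sub hr' hrw]
    by_cases h : ‖w‖ < r
    · rw [if_pos h, indicator_of_mem (show r ∈ Ioi ‖w‖ from h)]
      have := Real.pi_ne_zero
      push_cast
      field_simp
    · rw [if_neg h, indicator_of_notMem (show r ∉ Ioi ‖w‖ from h), mul_zero]
  have hae : ∀ᵐ r ∂volume.restrict (Ioi (0 : ℝ)),
      ∫ θ in Ioo (-Real.pi) Real.pi, r • f (Complex.polarCoord.symm (r, θ)) =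
        (Ioi ‖w‖).indicator (fun r => ((2 * r * Real.exp (-r ^ 2) : ℝ) : ℂ)) r := by
    filter_upwards [ae_restrict_mem measurableSet_Ioi,
      ae_restrict_of_ae (Measure.ae_ne volume ‖w‖)] with r h1 h2 using hinner r h1 h2
  rw [integral_congr_ae hae, setIntegral_indicator measurableSet_Ioi,
    inter_eq_right.2 (Ioi_subset_Ioi (norm_nonneg w)),
    integral_Ioi_mul_exp_neg_sq (norm_nonneg w)]

/-! ### Gaussian vectors and their unitary invariance. -/

theorem pi_stdComplexNormal_eq_withDensity {ι : Type*} [Fintype ι] :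
    Measure.pi (fun _ : ι => stdComplexNormal) = (volume : Measure (ι → ℂ)).withDensity
      fun c => ENNReal.ofReal (∏ i, (Real.pi⁻¹ * Real.exp (-‖c i‖ ^ 2))) := by
  refine Measure.pi_eq fun s hs => ?_
  have h1 : ∀ i, stdComplexNormal (s i) =
      ENNReal.ofReal (∫ z in s i, Real.pi⁻¹ * Real.exp (-‖z‖ ^ 2)) := fun i => by
    rw [stdComplexNormal, withDensity_apply _ (hs i),
      ofReal_integral_eq_lintegral_ofReal integrable_gaussianDensity.integrableOn
        (Filter.Eventually.of_forall fun z => by positivity)]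
  rw [withDensity_apply _ (MeasurableSet.univ_pi hs), volume_pi, Measure.restrict_pi_pi,
    ← ofReal_integral_eq_lintegral_ofReal
      (Integrable.fintype_prod fun i => integrable_gaussianDensity.integrableOn)
      (Filter.Eventually.of_forall fun c => Finset.prod_nonneg fun i _ => by positivity),
    integral_fintype_prod_eq_prod (fun _ : ι => fun z : ℂ => Real.pi⁻¹ * Real.exp (-‖z‖ ^ 2)),
    ENNReal.ofReal_prod_of_nonneg fun i _ =>
      integral_nonneg fun z => by positivity]
  exact Finset.prod_congr rfl fun i _ => (h1 i).symm

/-- The joint density depends only on the Euclidean norm, and a linear isomorphism multiplies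
Lebesgue measure by a constant. Hence the image law is a multiple of the original. -/
theorem measurePreserving_pi_stdComplexNormal {ι : Type*} [Fintype ι]
    (f : (ι → ℂ) ≃L[ℝ] (ι → ℂ)) (hf : ∀ c, ∑ i, ‖f c i‖ ^ 2 = ∑ i, ‖c i‖ ^ 2) :
    MeasurePreserving f (Measure.pi fun _ : ι => stdComplexNormal)
      (Measure.pi fun _ : ι => stdComplexNormal) := by
  have hfm : Measurable f := f.continuous.measurable
  refine ⟨hfm, ?_⟩
  obtain ⟨k, -, hk⟩ := LinearMap.exists_map_addHaar_eq_smul_addHaar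
    (f.toLinearEquiv : (ι → ℂ) →ₗ[ℝ] (ι → ℂ)) volume volume f.surjective
  set g : (ι → ℂ) → ENNReal :=
    fun c => ENNReal.ofReal (∏ i, (Real.pi⁻¹ * Real.exp (-‖c i‖ ^ 2))) with hg
  have hgm : Measurable g := by fun_prop
  have hgf : ∀ c, g (f c) = g c := fun c => by
    simp only [hg, Finset.prod_mul_distrib, ← Real.exp_sum, Finset.sum_neg_distrib, hf]
  have hmap : Measure.map f (Measure.pi fun _ : ι => stdComplexNormal) =
      k • Measure.pi fun _ : ι => stdComplexNormal := by
    rw [pi_stdComplexNormal_eq_withDensity]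
    ext s hs
    rw [Measure.map_apply hfm hs, withDensity_apply _ (hfm hs), Measure.smul_apply,
      withDensity_apply _ hs, ← lintegral_smul_measure, ← Measure.restrict_smul]
    calc _ = ∫⁻ c in f ⁻¹' s, g (f c) := by simp only [hgf]; rfl
      _ = ∫⁻ c in s, g c ∂Measure.map f volume := (setLIntegral_map hs hgm hfm).symm
      _ = _ := by
        rw [← hk]; rfl
  -- Both sides are probability measures up to `k`, so comparing total masses replaces a determinant
  -- computation.
  have h1 : k = 1 := by
    have := congrArg (fun m : Measure (ι → ℂ) => m univ) hmap
    simpa [Measure.map_apply hfm MeasurableSet.univ] using this.symm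
  rw [hmap, h1, one_smul]

open Classical in
-- Extend the unit vector `u = conj a / |a|` to an orthonormal basis and send the standard basis to
-- it. The form with coefficients `a` then sees only `c₀`, and `β 0` is the value of the form `b` at
-- `u`.
theorem exists_rotation {n : ℕ} (a : Fin (n + 1) → ℂ) (ha : 0 < ∑ j, ‖a j‖ ^ 2) :
    ∃ f : (Fin (n + 1) → ℂ) ≃L[ℝ] (Fin (n + 1) → ℂ),
      (∀ c, ∑ i, ‖f c i‖ ^ 2 = ∑ i, ‖c i‖ ^ 2) ∧
      (∀ c, ∑ j, f c j * a j = (√(∑ j, ‖a j‖ ^ 2) : ℝ) * c 0) ∧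
      ∀ b : Fin (n + 1) → ℂ, ∃ β : Fin (n + 1) → ℂ, (∀ c, ∑ j, f c j * b j = ∑ j, c j * β j) ∧
        β 0 = (∑ j, b j * starRingEnd ℂ (a j)) / (√(∑ j, ‖a j‖ ^ 2) : ℝ) := by
  set s : ℝ := √(∑ j, ‖a j‖ ^ 2) with hs
  have hs0 : 0 < s := Real.sqrt_pos.2 ha
  have hsC : (s : ℂ) ≠ 0 := by exact_mod_cast hs0.ne'
  -- The conjugate makes the bilinear pairing `∑ xⱼ aⱼ` equal to `s ⟪u, x⟫`.
  set u : EuclideanSpace ℂ (Fin (n + 1)) :=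
    (s : ℂ)⁻¹ • WithLp.toLp 2 (fun j => starRingEnd ℂ (a j)) with hu
  have hun : ‖u‖ = 1 := by
    rw [hu, norm_smul, EuclideanSpace.norm_eq]
    simp only [RCLike.norm_conj, ← hs, norm_inv, Complex.norm_real, Real.norm_of_nonneg hs0.le]
    exact inv_mul_cancel₀ hs0.ne'
  have horth : Orthonormal ℂ (({0} : Set (Fin (n + 1))).domRestrict fun _ => u) := by
    refine ⟨fun _ => hun, fun i j hij => absurd (Subsingleton.elim i j) hij⟩
  obtain ⟨B, hB⟩ := horth.exists_orthonormalBasis_extension_of_card_eq (by simp)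
  have hB0 : B 0 = u := hB 0 rfl
  let f : (Fin (n + 1) → ℂ) ≃ₗ[ℂ] (Fin (n + 1) → ℂ) :=
    (WithLp.linearEquiv 2 ℂ (Fin (n + 1) → ℂ)).symm ≪≫ₗ B.repr.symm.toLinearEquiv ≪≫ₗ
      WithLp.linearEquiv 2 ℂ (Fin (n + 1) → ℂ)
  have hfc : ∀ c j, f c j = ∑ i, c i * B i j := by
    intro c j
    have : f c j = (B.repr.symm (WithLp.toLp 2 c)) j := rfl
    rw [this, ← B.sum_repr_symm]
    simp
  have hsum : ∀ (c b : Fin (n + 1) → ℂ), ∑ j, f c j * b j = ∑ i, c i * ∑ j, B i j * b j := by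
    intro c b
    simp only [hfc, Finset.sum_mul, Finset.mul_sum]
    rw [Finset.sum_comm]
    simp only [mul_assoc]
  have hinner : ∀ i, ∑ j, B i j * a j = if i = 0 then (s : ℂ) else 0 := by
    intro i
    have h1 := orthonormal_iff_ite.1 B.orthonormal 0 i
    rw [hB0, hu, inner_smul_left, PiLp.inner_apply] at h1
    simp only [RCLike.inner_apply, map_inv₀, Complex.conj_ofReal, Complex.conj_conj] at h1
    rw [inv_mul_eq_iff_eq_mul₀ hsC] at h1
    rw [h1]
    simp [eq_comm]
  refine ⟨(f.restrictScalars ℝ).toContinuousLinearEquiv, fun c => ?_, fun c => ?_, fun b => ?_⟩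
  · have h1 := B.repr.symm.norm_map (WithLp.toLp 2 c)
    rw [EuclideanSpace.norm_eq, EuclideanSpace.norm_eq,
      Real.sqrt_inj (by positivity) (by positivity)] at h1
    exact h1
  · refine (hsum c a).trans ?_
    simp only [hinner]
    simp [mul_comm]
  · refine ⟨fun i => ∑ j, B i j * b j, fun c => hsum c b, ?_⟩
    simp only
    rw [hB0, Finset.sum_div]
    refine Finset.sum_congr rfl fun j _ => ?_
    simp [hu]
    ring

/-! ### Quotients of linear forms in a Gaussian vector. -/

theorem measurePreserving_zero_succ (n : ℕ) :
    MeasurePreserving (fun c : Fin (n + 1) → ℂ => (c 0, fun j : Fin n => c j.succ))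
      (Measure.pi fun _ => stdComplexNormal)
      (stdComplexNormal.prod (Measure.pi fun _ => stdComplexNormal)) :=
  measurePreserving_piFinSuccAbove (fun _ : Fin (n + 1) => stdComplexNormal) 0

theorem integrable_eval_stdComplexNormal {n : ℕ} (j : Fin n) :
    Integrable (fun c : Fin n → ℂ => c j) (Measure.pi fun _ => stdComplexNormal) :=
  (measurePreserving_eval (fun _ : Fin n => stdComplexNormal) j).integrable_comp_of_integrable
    integrable_id_stdComplexNormal

theorem integral_eval_stdComplexNormal {n : ℕ} (j : Fin n) :
    ∫ c : Fin n → ℂ, c j ∂(Measure.pi fun _ => stdComplexNormal) = 0 := by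
  have h := measurePreserving_eval (fun _ : Fin n => stdComplexNormal) j
  have h1 := integral_map (μ := Measure.pi fun _ : Fin n => stdComplexNormal)
    (f := fun z : ℂ => z) h.measurable.aemeasurable measurable_id.aestronglyMeasurable
  rwa [h.map_eq, integral_id_stdComplexNormal, eq_comm] at h1

theorem integrable_inv_mul_sub {s : ℂ} (hs : s ≠ 0) (v : ℂ) :
    Integrable (fun z => (s * z - v)⁻¹) stdComplexNormal := by
  refine ((integrable_inv_sub (v / s)).const_mul s⁻¹).congr (.of_forall fun z => ?_)
  simp only
  rw [← mul_inv, mul_sub, mul_div_cancel₀ _ hs]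

theorem div_mul_sub_eq {s : ℂ} (hs : s ≠ 0) (v z : ℂ) :
    z / (s * z - v) = s⁻¹ * (z / (z - v / s)) := by
  have h : s * z - v = s * (z - v / s) := by rw [mul_sub, mul_div_cancel₀ _ hs]
  rw [h, inv_mul_eq_div, div_div, mul_comm s]

theorem integrable_div_mul_sub {s : ℂ} (hs : s ≠ 0) (v : ℂ) :
    Integrable (fun z => z / (s * z - v)) stdComplexNormal := by
  simp only [div_mul_sub_eq hs]
  exact (integrable_div_sub (v / s)).const_mul s⁻¹

theorem integral_div_mul_sub {s : ℂ} (hs : s ≠ 0) (v : ℂ) :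
    ∫ z, z / (s * z - v) ∂stdComplexNormal = s⁻¹ * Real.exp (-‖v / s‖ ^ 2) := by
  simp only [div_mul_sub_eq hs]
  rw [integral_const_mul, integral_div_sub]

/-- The terms with `j ≥ 1` are independent of `c 0` and have mean zero, so only `β 0 * c 0 / (s * c
0 - v)` contributes. -/
theorem integral_linear_div_first_sub {n : ℕ} {s : ℂ} (hs : s ≠ 0) (v : ℂ)
    (β : Fin (n + 1) → ℂ) :
    ∫ c : Fin (n + 1) → ℂ, (∑ j, c j * β j) / (s * c 0 - v)
      ∂(Measure.pi fun _ => stdComplexNormal) = β 0 * (s⁻¹ * Real.exp (-‖v / s‖ ^ 2)) := by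
  have hmp := measurePreserving_zero_succ n
  have hL : Integrable (fun y : Fin n → ℂ => ∑ j, y j * β j.succ)
      (Measure.pi fun _ => stdComplexNormal) :=
    integrable_finsetSum _ fun j _ => (integrable_eval_stdComplexNormal j).mul_const _
  have hL0 : ∫ y : Fin n → ℂ, ∑ j, y j * β j.succ ∂(Measure.pi fun _ => stdComplexNormal) = 0 := by
    rw [integral_finsetSum _ fun j _ => (integrable_eval_stdComplexNormal j).mul_const _]
    simp [integral_mul_const, integral_eval_stdComplexNormal]
  -- The factor `1` makes the first summand a product of functions of the two independent blocks, as
  -- `integral_prod_mul` requires.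
  have h1 : ∀ c : Fin (n + 1) → ℂ, (∑ j, c j * β j) / (s * c 0 - v) =
      (fun p : ℂ × (Fin n → ℂ) => (β 0 * (p.1 / (s * p.1 - v))) * 1 +
        (s * p.1 - v)⁻¹ * ∑ j, p.2 j * β j.succ) (c 0, fun j => c j.succ) := fun c => by
    rw [Fin.sum_univ_succ]
    ring
  simp only [h1]
  rw [← integral_map (φ := fun c : Fin (n + 1) → ℂ => (c 0, fun j : Fin n => c j.succ))
      (f := fun p : ℂ × (Fin n → ℂ) => (β 0 * (p.1 / (s * p.1 - v))) * 1 +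
        (s * p.1 - v)⁻¹ * ∑ j, p.2 j * β j.succ)
      hmp.measurable.aemeasurable (Measurable.aestronglyMeasurable (by fun_prop)), hmp.map_eq,
    integral_add (((integrable_div_mul_sub hs v).const_mul (β 0)).mul_prod (integrable_const 1))
      ((integrable_inv_mul_sub hs v).mul_prod hL),
    integral_prod_mul (fun z => β 0 * (z / (s * z - v))) (fun _ => (1 : ℂ)),
    integral_prod_mul (fun z => (s * z - v)⁻¹) (fun y : Fin n → ℂ => ∑ j, y j * β j.succ), hL0,
    integral_const_mul, integral_div_mul_sub hs]
  simp

theorem integral_linear_div_linear_sub {n : ℕ} (a b : Fin (n + 1) → ℂ)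
    (ha : 0 < ∑ j, ‖a j‖ ^ 2) (v : ℂ) :
    ∫ c : Fin (n + 1) → ℂ, (∑ j, c j * b j) / (∑ j, c j * a j - v)
      ∂(Measure.pi fun _ => stdComplexNormal) =
      (∑ j, b j * starRingEnd ℂ (a j)) / (∑ j, ‖a j‖ ^ 2 : ℝ) *
        Real.exp (-‖v‖ ^ 2 / ∑ j, ‖a j‖ ^ 2) := by
  obtain ⟨f, hf, hfa, hfb⟩ := exists_rotation a ha
  obtain ⟨β, hβ, hβ0⟩ := hfb b
  have hmp := measurePreserving_pi_stdComplexNormal f hf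
  have hs0 : 0 < √(∑ j, ‖a j‖ ^ 2) := Real.sqrt_pos.2 ha
  have hsC : ((√(∑ j, ‖a j‖ ^ 2) : ℝ) : ℂ) ≠ 0 := by exact_mod_cast hs0.ne'
  have hsq : ((√(∑ j, ‖a j‖ ^ 2) : ℝ) : ℂ) ^ 2 = (∑ j, ‖a j‖ ^ 2 : ℝ) := by
    rw [← Complex.ofReal_pow, Real.sq_sqrt ha.le]
  rw [← hmp.integral_comp f.toHomeomorph.measurableEmbedding]
  simp only [hfa, hβ]
  rw [integral_linear_div_first_sub hsC, hβ0, norm_div, Complex.norm_real,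
    Real.norm_of_nonneg hs0.le, div_pow, Real.sq_sqrt ha.le, ← neg_div, ← hsq]
  field_simp

/-- As `b 0 = 0`, the numerator is free of `c 0`. With the other variables fixed, the denominator is
affine in `c 0` with slope `a 0`, so its reciprocal is bounded in mean uniformly in those variables
and in `v`. -/
theorem exists_lintegral_linear_div_linear_sub_le (n : ℕ) :
    ∃ C : ENNReal, C ≠ ⊤ ∧ ∀ (a b : Fin (n + 1) → ℂ) (v : ℂ), a 0 ≠ 0 → b 0 = 0 →
      ∫⁻ c : Fin (n + 1) → ℂ, ‖(∑ j, c j * b j) / (∑ j, c j * a j - v)‖ₑ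
        ∂(Measure.pi fun _ => stdComplexNormal) ≤ ‖(a 0)⁻¹‖ₑ * (∑ j, ‖b j‖ₑ) * C := by
  obtain ⟨C, hC, h⟩ := exists_lintegral_inv_sub_le
  set D := ∫⁻ z : ℂ, ‖z‖ₑ ∂stdComplexNormal with hD
  have hDtop : D ≠ ⊤ := integrable_id_stdComplexNormal.2.ne
  refine ⟨C * D, ENNReal.mul_ne_top hC hDtop, fun a b v ha hb => ?_⟩
  have hmp := measurePreserving_zero_succ n
  have hinv : ∀ A : ℂ, ∫⁻ z, ‖(z * a 0 + A - v)⁻¹‖ₑ ∂stdComplexNormal ≤ ‖(a 0)⁻¹‖ₑ * C := by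
    intro A
    have h1 : ∀ z, ‖(z * a 0 + A - v)⁻¹‖ₑ = ‖(a 0)⁻¹‖ₑ * ‖(z - (v - A) / a 0)⁻¹‖ₑ := fun z => by
      rw [← enorm_mul, ← mul_inv, mul_sub, mul_div_cancel₀ _ ha]
      ring_nf
    simp only [h1]
    rw [lintegral_const_mul _ (by fun_prop)]
    gcongr
    exact h _
  have hlin : ∫⁻ y : Fin n → ℂ, ‖∑ j, y j * b j.succ‖ₑ ∂(Measure.pi fun _ => stdComplexNormal) ≤
      (∑ j, ‖b j‖ₑ) * D := by
    calc _ ≤ ∫⁻ y : Fin n → ℂ, ∑ j, ‖y j‖ₑ * ‖b j.succ‖ₑ ∂(Measure.pi fun _ => stdComplexNormal) :=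
          lintegral_mono fun y => (enorm_sum_le _ _).trans_eq (by simp only [enorm_mul])
      _ = ∑ j : Fin n, D * ‖b j.succ‖ₑ := by
          rw [lintegral_finsetSum _ fun j _ => by fun_prop]
          refine Finset.sum_congr rfl fun j _ => ?_
          rw [lintegral_mul_const _ (by fun_prop)]
          congr 1
          exact (measurePreserving_eval (fun _ : Fin n => stdComplexNormal) j).lintegral_comp
            (f := fun z : ℂ => ‖z‖ₑ) (by fun_prop)
      _ = _ := by
          rw [Fin.sum_univ_succ, hb, enorm_zero, zero_add, ← Finset.mul_sum, mul_comm]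
  set F : ℂ × (Fin n → ℂ) → ENNReal := fun p => ‖∑ j, p.2 j * b j.succ‖ₑ *
    ‖(p.1 * a 0 + (∑ j, p.2 j * a j.succ) - v)⁻¹‖ₑ with hF
  have hFm : Measurable F := by fun_prop
  have h1 : ∀ c : Fin (n + 1) → ℂ, ‖(∑ j, c j * b j) / (∑ j, c j * a j - v)‖ₑ =
      F (c 0, fun j => c j.succ) := fun c => by
    rw [hF, Fin.sum_univ_succ, Fin.sum_univ_succ, hb, mul_zero, zero_add, div_eq_mul_inv, enorm_mul]
  simp only [h1]
  rw [hmp.lintegral_comp hFm, lintegral_prod_symm' _ hFm]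
  calc _ ≤ ∫⁻ y : Fin n → ℂ, ‖∑ j, y j * b j.succ‖ₑ * (‖(a 0)⁻¹‖ₑ * C)
        ∂(Measure.pi fun _ => stdComplexNormal) := by
        refine lintegral_mono fun y => ?_
        simp only [hF]
        rw [lintegral_const_mul _ (by fun_prop)]
        gcongr
        exact hinv _
    _ ≤ _ := by
        rw [lintegral_mul_const _ (by fun_prop)]
        calc _ ≤ (∑ j, ‖b j‖ₑ) * D * (‖(a 0)⁻¹‖ₑ * C) := by gcongr
          _ = _ := by ring

/-! ### The argument principle on a cycle. -/

namespace Cycle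

theorem continuousOn_one_div_sub (Γ : Cycle) {r : ℂ} (hr : r ∉ Γ.trace) :
    ContinuousOn (fun z => 1 / (z - r)) Γ.trace :=
  continuousOn_const.div (continuousOn_id.sub continuousOn_const)
    fun _ hz h => hr (sub_eq_zero.1 h ▸ hz)

open Classical in
-- Each root contributes its index, which is 1 or 0: for open `Θ`, a point off the trace and not in
-- `Θ` is outside `closure Θ`. Continuity is carried through the induction because additivity of the
-- integral needs it.
theorem IsPositiveBoundary.countP_mem_eq {Γ : Cycle} {Θ : Set ℂ} (hΓ : Γ.IsPositiveBoundary Θ)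
    (hΘ : IsOpen Θ) (M : Multiset ℂ) (hM : ∀ r ∈ M, r ∉ Γ.trace) :
    (Multiset.countP (· ∈ Θ) M : ℂ) = (2 * Real.pi * Complex.I)⁻¹ *
        Γ.integral (fun z => (M.map fun r => 1 / (z - r)).sum) ∧
      ContinuousOn (fun z => (M.map fun r => 1 / (z - r)).sum) Γ.trace := by
  induction M using Multiset.induction_on with
  | empty => simp [integral_eq_sum_deriv, continuousOn_const]
  | cons r M ih =>
    obtain ⟨ih1, ih2⟩ := ih fun x hx => hM x (Multiset.mem_cons_of_mem hx)
    have hr := hM r (Multiset.mem_cons_self r M)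
    have hc := Γ.continuousOn_one_div_sub hr
    simp only [Multiset.map_cons, Multiset.sum_cons]
    refine ⟨?_, hc.add ih2⟩
    rw [Γ.integral_add hc ih2, mul_add, ← ih1]
    have hidx : (2 * Real.pi * Complex.I)⁻¹ * Γ.integral (fun z => 1 / (z - r)) = Γ.index r := by
      simp only [index, one_div]
    rw [hidx]
    by_cases h : r ∈ Θ
    · rw [Multiset.countP_cons_of_pos _ h, hΓ.index_inside r h]
      push_cast
      ring
    · have hcl : r ∉ closure Θ := fun h1 => hr <| by
        rw [hΓ.trace_eq, frontier, hΘ.interior_eq]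
        exact ⟨h1, h⟩
      rw [Multiset.countP_cons_of_neg _ h, hΓ.index_outside r hcl, zero_add]

/-- The argument principle for polynomials. -/
theorem IsPositiveBoundary.numRoots_eq {Γ : Cycle} {Θ : Set ℂ} (hΓ : Γ.IsPositiveBoundary Θ)
    (hΘ : IsOpen Θ) (p : ℂ[X]) (v : ℂ) (hp : ∀ z ∈ Γ.trace, p.eval z ≠ v) :
    (numRoots p v Θ : ℂ) = (2 * Real.pi * Complex.I)⁻¹ *
        Γ.integral fun z => p.derivative.eval z / (p.eval z - v) := by
  rw [numRoots, (hΓ.countP_mem_eq hΘ _ fun r hr h => ?_).1]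
  · congr 1
    refine Γ.integral_congr fun z hz => ?_
    -- The logarithmic derivative of `p - v` is the sum of `1 / (z - r)` over its roots.
    have h := (IsAlgClosed.splits (p - C v)).eval_derivative_div_eval_of_ne_zero (x := z)
      (by simpa [sub_eq_zero] using hp z hz)
    rw [← h]
    simp
  · have := Polynomial.isRoot_of_mem_roots hr
    rw [IsRoot, eval_sub, eval_C, sub_eq_zero] at this
    exact hp r h this

end Cycle

/-! ### The random polynomial: no roots on the boundary, and Fubini. -/

theorem eval_combination {n : ℕ} (φ : Fin (n + 1) → ℂ[X]) (c : Fin (n + 1) → ℂ) (z : ℂ) :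
    (combination φ c).eval z = ∑ j, c j * (φ j).eval z := by
  simp [combination, eval_finsetSum]

theorem eval_derivative_combination {n : ℕ} (φ : Fin (n + 1) → ℂ[X]) (c : Fin (n + 1) → ℂ)
    (z : ℂ) :
    (combination φ c).derivative.eval z = ∑ j, c j * (φ j).derivative.eval z := by
  simp [combination, eval_finsetSum]

/-- For fixed `c₁, …, cₙ` the bad values of `c₀` form the image of `T` under a polynomial map, which
is null because differentiable maps preserve null sets. -/
theorem ae_forall_eval_combination_ne {n : ℕ} {φ : Fin (n + 1) → ℂ[X]} {a : ℂ} (ha : a ≠ 0)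
    (hφ : φ 0 = C a) (v : ℂ) {T : Set ℂ} (hT : IsCompact T) (hT0 : volume T = 0) :
    ∀ᵐ c ∂(Measure.pi fun _ : Fin (n + 1) => stdComplexNormal),
      ∀ z ∈ T, (combination φ c).eval z ≠ v := by
  set S : Set (ℂ × (Fin n → ℂ)) :=
    {p | ∃ z ∈ T, p.1 * a + ∑ j, p.2 j * (φ j.succ).eval z = v} with hS
  -- `S` is the projection of a closed set along the compact `T`; closedness supplies the
  -- measurability needed for Tonelli.
  have hclosed : IsClosed S := by
    have : CompactSpace T := isCompact_iff_compactSpace.1 hT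
    have h1 : IsClosed {q : T × (ℂ × (Fin n → ℂ)) |
        q.2.1 * a + ∑ j, q.2.2 j * (φ j.succ).eval (q.1 : ℂ) = v} := by
      refine isClosed_eq ?_ continuous_const
      have : ∀ j : Fin n, Continuous fun q : T × (ℂ × (Fin n → ℂ)) =>
          (φ j.succ).eval (q.1 : ℂ) := fun j => (φ j.succ).continuous.comp (by fun_prop)
      fun_prop
    convert isClosedMap_snd_of_compactSpace _ h1 using 1
    ext p
    simp [hS]
  have hnull : (stdComplexNormal.prod (Measure.pi fun _ : Fin n => stdComplexNormal)) S = 0 := by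
    rw [Measure.prod_apply_symm hclosed.measurableSet]
    refine lintegral_eq_zero_of_ae_eq_zero (.of_forall fun y => ?_)
    refine stdComplexNormal_absolutelyContinuous (measure_mono_null (t := (fun z =>
      (v - ∑ j, y j * (φ j.succ).eval z) / a) '' T) ?_ ?_)
    · rintro x ⟨z, hz, hx⟩
      refine ⟨z, hz, ?_⟩
      simp only at hx ⊢
      rw [← hx, add_sub_cancel_right, mul_div_cancel_right₀ _ ha]
    · refine addHaar_image_eq_zero_of_differentiableOn_of_addHaar_eq_zero volume
        (Differentiable.differentiableOn ?_) hT0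
      refine Differentiable.restrictScalars ℝ (𝕜' := ℂ) ?_
      have : ∀ j : Fin n, Differentiable ℂ fun z => (φ j.succ).eval z :=
        fun j => (φ j.succ).differentiable
      fun_prop
  have h2 := (measurePreserving_zero_succ n).quasiMeasurePreserving.ae
    (measure_eq_zero_iff_ae_notMem.1 hnull)
  filter_upwards [h2] with c hc z hz h
  refine hc ⟨z, hz, ?_⟩
  rw [eval_combination, Fin.sum_univ_succ, hφ, eval_C] at h
  exact h

theorem kernel_self {n : ℕ} (φ : Fin (n + 1) → ℂ[X]) (z : ℂ) :
    kernel φ z z = (∑ j, ‖(φ j).eval z‖ ^ 2 : ℝ) := by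
  simp [kernel, Complex.mul_conj, Complex.normSq_eq_norm_sq]

theorem conj_kernelDeriv_zero_one {n : ℕ} (φ : Fin (n + 1) → ℂ[X]) (z : ℂ) :
    starRingEnd ℂ (kernelDeriv φ 0 1 z z) =
      ∑ j, (φ j).derivative.eval z * starRingEnd ℂ ((φ j).eval z) := by
  simp [kernelDeriv, mul_comm]

theorem integral_logDeriv_combination {n : ℕ} (φ : Fin (n + 1) → ℂ[X]) (v : ℂ) {z : ℂ}
    (hz : (φ 0).eval z ≠ 0) :
    ∫ c, (combination φ c).derivative.eval z / ((combination φ c).eval z - v)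
      ∂(Measure.pi fun _ : Fin (n + 1) => stdComplexNormal) =
      starRingEnd ℂ (kernelDeriv φ 0 1 z z) / kernel φ z z *
        Complex.exp (-(‖v‖ : ℂ) ^ 2 / kernel φ z z) := by
  simp only [eval_combination, eval_derivative_combination]
  rw [integral_linear_div_linear_sub _ _ _ v, kernel_self, conj_kernelDeriv_zero_one]
  · push_cast
    rfl
  · exact Finset.sum_pos' (fun _ _ => by positivity) ⟨0, Finset.mem_univ _, by positivity⟩

/-- This is the Fubini hypothesis. The speed is bounded, the `φⱼ'` are bounded on the compact trace,
and the constancy of `φ 0` puts the quotient within reach of the uniform bound for linear forms. -/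
theorem integrable_deriv_mul_logDeriv_combination {n : ℕ} {φ : Fin (n + 1) → ℂ[X]} {a : ℂ}
    (ha : a ≠ 0) (hφ : φ 0 = C a) (v : ℂ) (Γ : Cycle) (i : Fin Γ.num) :
    Integrable (fun p : (Fin (n + 1) → ℂ) × ℝ => deriv (Γ.path i).extend p.2 *
        ((combination φ p.1).derivative.eval ((Γ.path i).extend p.2) /
          ((combination φ p.1).eval ((Γ.path i).extend p.2) - v)))
      ((Measure.pi fun _ : Fin (n + 1) => stdComplexNormal).prod
        (volume.restrict (Ioc (0 : ℝ) 1))) := by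
  have hmeas : Measurable fun p : (Fin (n + 1) → ℂ) × ℝ => deriv (Γ.path i).extend p.2 *
        ((combination φ p.1).derivative.eval ((Γ.path i).extend p.2) /
          ((combination φ p.1).eval ((Γ.path i).extend p.2) - v)) := by
    have h1 : ∀ q : ℂ[X], Measurable fun t => q.eval ((Γ.path i).extend t) :=
      fun q => (q.continuous.comp (Γ.path i).continuous_extend).measurable
    have h2 : Measurable fun t => deriv (Γ.path i).extend t := measurable_deriv _
    simp only [eval_combination, eval_derivative_combination]
    fun_prop
  refine ⟨hmeas.aestronglyMeasurable, ?_⟩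
  obtain ⟨K, hK, hbound⟩ := exists_lintegral_linear_div_linear_sub_le n
  obtain ⟨D, hD⟩ := (Γ.piecewiseC1 i).exists_bound_deriv
  obtain ⟨M, hM⟩ := Γ.isCompact_trace.exists_bound_of_continuousOn
    (f := fun z => ∑ j, ‖(φ j).derivative.eval z‖)
    (continuous_finsetSum _ fun j _ => (φ j).derivative.continuous.norm).continuousOn
  rw [HasFiniteIntegral, lintegral_prod_symm' _ hmeas.enorm]
  calc _ ≤ ∫⁻ _ in Ioc (0 : ℝ) 1, ENNReal.ofReal D * (‖a⁻¹‖ₑ * ENNReal.ofReal M * K) := by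
        refine lintegral_mono_ae ?_
        filter_upwards [hD] with t ht
        simp only [enorm_mul]
        rw [lintegral_const_mul' _ _ enorm_ne_top]
        refine mul_le_mul' ?_ ?_
        · rw [← ofReal_norm]
          exact ENNReal.ofReal_le_ofReal ht
        · simp only [eval_combination, eval_derivative_combination]
          refine (hbound _ _ v (by simpa [hφ] using ha) (by simp [hφ])).trans ?_
          simp only [hφ, eval_C]
          gcongr
          simp only [← ofReal_norm]
          rw [← ENNReal.ofReal_sum_of_nonneg fun _ _ => norm_nonneg _]
          exact ENNReal.ofReal_le_ofReal
            ((le_abs_self _).trans (hM _ (Γ.extend_mem_trace i t)))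
    _ < ⊤ := by
        rw [lintegral_const]
        refine ENNReal.mul_lt_top (ENNReal.mul_lt_top ENNReal.ofReal_lt_top
          (ENNReal.mul_lt_top (ENNReal.mul_lt_top enorm_lt_top ENNReal.ofReal_lt_top)
            hK.lt_top)) (by simp)

theorem integrable_and_integral_numRoots {n : ℕ} {φ : Fin (n + 1) → ℂ[X]} {a : ℂ}
    (ha : a ≠ 0) (hφ : φ 0 = C a) (v : ℂ) {Θ : Set ℂ} (hΘ : IsOpen Θ) {Γ : Cycle}
    (hΓ : Γ.IsPositiveBoundary Θ) :
    Integrable (fun c => (numRoots (combination φ c) v Θ : ℂ))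
        (Measure.pi fun _ : Fin (n + 1) => stdComplexNormal) ∧
      ∫ c, (numRoots (combination φ c) v Θ : ℂ)
          ∂(Measure.pi fun _ : Fin (n + 1) => stdComplexNormal) =
        (2 * Real.pi * Complex.I)⁻¹ * Γ.integral fun z =>
          starRingEnd ℂ (kernelDeriv φ 0 1 z z) / kernel φ z z *
            Complex.exp (-(‖v‖ : ℂ) ^ 2 / kernel φ z z) := by
  have hH := integrable_deriv_mul_logDeriv_combination ha hφ v Γ
  have hae : (fun c => (numRoots (combination φ c) v Θ : ℂ))
      =ᵐ[Measure.pi fun _ : Fin (n + 1) => stdComplexNormal] fun c =>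
        (2 * Real.pi * Complex.I)⁻¹ * ∑ i, ∫ t in Ioc (0 : ℝ) 1,
          deriv (Γ.path i).extend t *
            ((combination φ c).derivative.eval ((Γ.path i).extend t) /
              ((combination φ c).eval ((Γ.path i).extend t) - v)) := by
    filter_upwards [ae_forall_eval_combination_ne ha hφ v Γ.isCompact_trace Γ.volume_trace]
      with c hc
    rw [hΓ.numRoots_eq hΘ _ v hc, Cycle.integral_eq_sum_deriv]
  have hi : ∀ i, Integrable (fun c => ∫ t in Ioc (0 : ℝ) 1,
      deriv (Γ.path i).extend t *
        ((combination φ c).derivative.eval ((Γ.path i).extend t) /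
          ((combination φ c).eval ((Γ.path i).extend t) - v)))
      (Measure.pi fun _ : Fin (n + 1) => stdComplexNormal) :=
    fun i => (hH i).integral_prod_left
  refine ⟨((integrable_finsetSum _ fun i _ => hi i).const_mul _).congr hae.symm, ?_⟩
  rw [integral_congr_ae hae, integral_const_mul, integral_finsetSum _ fun i _ => hi i,
    Cycle.integral_eq_sum_deriv]
  congr 1
  refine Finset.sum_congr rfl fun i _ => ?_
  rw [integral_integral_swap (hH i)]
  refine integral_congr_ae (.of_forall fun t => ?_)
  simp only
  rw [integral_const_mul, integral_logDeriv_combination φ v (by simpa [hφ] using ha)]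

end RandomLevelRoots

theorem theorem1p2 {Ω : Type*} [MeasurableSpace Ω] (P : Measure Ω) [IsProbabilityMeasure P]
    (n : ℕ)
    -- i.i.d. standard complex normal coefficients
    (η : Fin (n + 1) → Ω → ℂ)
    (hη_meas : ∀ j, AEMeasurable (η j) P)
    (hη_law : ∀ j, Measure.map (η j) P = RandomLevelRoots.stdComplexNormal)
    (hη_indep : iIndepFun η P)
    -- the basis polynomials
    (φ : Fin (n + 1) → ℂ[X])
    (hφ : ∀ j, (φ j).degree = ((j : ℕ) : WithBot ℕ))
    (v : ℂ)
    -- the domain and its positively oriented boundary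
    (Θ : Set ℂ) (hΘ_open : IsOpen Θ) (hΘ_conn : IsConnected Θ)
    (hΘ_bdd : Bornology.IsBounded Θ)
    (Γ : RandomLevelRoots.Cycle) (hΓ : Γ.IsPositiveBoundary Θ) :
    Integrable (fun ω => (RandomLevelRoots.numRoots
      (RandomLevelRoots.combination φ fun j => η j ω) v Θ : ℝ)) P ∧
    ((∫ ω, (RandomLevelRoots.numRoots
      (RandomLevelRoots.combination φ fun j => η j ω) v Θ : ℝ) ∂P : ℝ) : ℂ) =
      1 / (2 * Real.pi * Complex.I) *
        Γ.integral fun z =>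
          (starRingEnd ℂ) (RandomLevelRoots.kernelDeriv φ 0 1 z z) /
              RandomLevelRoots.kernel φ z z *
            Complex.exp (-(‖v‖ : ℂ) ^ 2 / RandomLevelRoots.kernel φ z z) := by
  have hdeg : (φ 0).degree = 0 := hφ 0
  have hφ0 := eq_C_of_degree_le_zero hdeg.le
  have ha : (φ 0).coeff 0 ≠ 0 := fun h => by
    rw [hφ0, h, C_0, degree_zero] at hdeg
    exact absurd hdeg (by simp)
  obtain ⟨hint, heq⟩ :=
    RandomLevelRoots.integrable_and_integral_numRoots ha hφ0 v hΘ_open hΓ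
  have hmeas : AEMeasurable (fun ω j => η j ω) P := aemeasurable_pi_lambda _ hη_meas
  -- Independence and the common law make the joint law a product, so the claim becomes one about
  -- the coefficient space.
  have hmap : Measure.map (fun ω j => η j ω) P =
      Measure.pi fun _ : Fin (n + 1) => RandomLevelRoots.stdComplexNormal := by
    rw [(iIndepFun_iff_map_fun_eq_pi_map hη_meas).1 hη_indep]
    simp only [hη_law]
  rw [← hmap] at hint heq
  have hP := hint.comp_aemeasurable hmeas
  rw [integral_map hmeas hint.aestronglyMeasurable] at heq
  refine ⟨by simpa using hP.re, ?_⟩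
  rw [one_div, ← heq, ← integral_complex_ofReal]
  simp
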